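/- Let $n,k,d$ be integers with $n\ge 2$, $1\le k\le n-1$, $1\le d\le n-1$, and put $m=n-d$, $c=\lfloor n/m\rfloor$, $r=n\bmod m$. **Family helper selection (FHS).** Nodes $1,\dots,n$ are split consecutively into $c$ complete families of $m$ nodes and, if $r\neq0$, one incomplete family consisting of the last $r$ nodes. The helper set $D_i$ of a node $i$ in a complete family is the set of all nodes outside its family; for a node $i$ in the incomplete family $D_i=\{1,\dots,d\}$. **Family index permutations.** The nodes of the complete families have family index $1,\dots,c$ and those of the incomplete family have index $0$; if $r\ne 0$, the last $m-r$ nodes of family $c$ (those not in $\{1,\dots,d\}$) have index $-c$ instead of $c$. A family index permutation $\pi$ is any rearrangement of the resulting vector of $n$ indices. The rotating family index permutation $\pi_f^*$ is obtained by writing the vector column by column into a table with $m$ rows and $\lceil n/m\rceil$ columns and reading the table row by row, skipping blank cells. If the $i$-th coordinate of $\pi$ is $0$, $y_i(\pi)$ is the number of $j<i$ whose coordinate is positive; otherwise $y_i(\pi)$ is the number of $j<i$ whose coordinate differs in absolute value from the $i$-th one. **MBR point.** For a finite sequence of node failures, the information flow graph has a source $s$ joined by edges of infinite capacity to the inputs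 of the $n$ initial nodes; every node instance (initial node or newcomer) has an input vertex joined to its output vertex by an edge of capacity $\alpha$; the newcomer replacing a failed node $i$ receives an edge of capacity $\beta$ from the output of the currently active instance of each node in $D_i$; and for each choice of $k$ of the $n$ finally active nodes a data collector receives edges of infinite capacity from their outputs. Let $g(\alpha,\beta)$ be the minimum, over all failure sequences and all data collectors $t$, of the min-cut value between $s$ and $t$. For file size $\mathcal M>0$ let $\beta_{\mathrm{MBR}}=\min\{\beta: g(\infty,\beta)\ge\mathcal M\}$, $\alpha_{\mathrm{MBR}}=\min\{\alpha: g(\alpha,\beta_{\mathrm{MBR}})\ge \mathcal M\}$ and $\gamma_{\mathrm{MBR}}=d\beta_{\mathrm{MBR}}$. **Proposition.** 1. For all real $\beta\ge0$ and $\alpha\ge d\beta$, the family index permutation $\pi_f^*$ minimizes $\sum_{i=1}^k\min\big((d-y_i(\pi))\beta,\alpha\big)$ over all family index permutations $\pi$. 2. For every real $\mathcal M>0$ the MBR point exists, and $$\alpha_{\mathrm{MBR}}=\gamma_{\mathrm{MBR}}=d\,\beta_{\mathrm{MBR}}=\frac{d\,\mathcal M}{\sum_{i=1}^k\big(d-y_i(\pi_f^*)\big)}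 .$$ 3. These values are computable in polynomial time: there is a random access machine program (instructions: constant, $+$, truncated $-$, $\times$, integer division, indirect load and store, jump if zero; the cost of an instruction is the product of the operands' binary lengths, each increased by one, for $\times$ and division, and one plus the binary lengths involved otherwise) which, for all $n,k,d$ as above and all integers $a,b\ge 1$, given $(n,k,d,a,b)$, outputs $\alpha_{\mathrm{MBR}},\beta_{\mathrm{MBR}},\gamma_{\mathrm{MBR}}$ for $\mathcal M=a/b$ as fractions of natural numbers, at a total cost bounded by a fixed polynomial in the total binary length of $n,k,d,a,b$. -/

import Mathlib

open scoped NNReal ENNReal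

namespace DistStorage

/-! ### Information flow graphs of a stationary helper selection scheme

Nodes are `0, …, n - 1`.  A stationary helper selection scheme is a map `D` sending each node `i`
to the set `D i` of the helpers that are contacted whenever node `i` fails.  A failure history of
length `T` is a map `F : Fin T → Fin n`; at time `τ` node `F τ` fails and is replaced. -/

/-- Storage-node instances after `T` failures: the `n` initial nodes and the `T` newcomers. -/
abbrev Instance (n T : ℕ) : Type := Fin n ⊕ Fin T

/-- The index in `{0, …, n - 1}` of a storage-node instance. -/
def nodeIndex {n T : ℕ} (F : Fin T → Fin n) : Instance n T → Fin n
  | .inl i => i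
  | .inr σ => F σ

/-- The instance `x` is active at time `τ`, i.e. just before the failure number `τ` takes place:
it has already been created and it has not failed since. -/
def ActiveAt {n T : ℕ} (F : Fin T → Fin n) (τ : ℕ) : Instance n T → Prop
  | .inl i => ∀ ρ : Fin T, (ρ : ℕ) < τ → F ρ ≠ i
  | .inr σ => (σ : ℕ) < τ ∧ ∀ ρ : Fin T, (σ : ℕ) < ρ → (ρ : ℕ) < τ → F ρ ≠ F σ

/-- Vertices of the information flow graph: the source, the input and the output vertex of every
storage-node instance, and one data collector for each choice of `k` of the `n` active nodes. -/
inductive Vertex (n k T : ℕ) : Type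
  | source : Vertex n k T
  | inp (x : Instance n T) : Vertex n k T
  | out (x : Instance n T) : Vertex n k T
  | collector (S : {S : Finset (Fin n) // S.card = k}) : Vertex n k T
  deriving DecidableEq, Fintype

open Classical in
/-- Edge capacities of the information flow graph (capacity `0` means that there is no edge). -/
noncomputable def capacity {n T : ℕ} (k : ℕ) (D : Fin n → Finset (Fin n)) (F : Fin T → Fin n)
    (α β : ℝ≥0∞) : Vertex n k T → Vertex n k T → ℝ≥0∞
  | .source, .inp (.inl _) => ⊤
  | .inp x, .out y => if x = y then α else 0
  | .out x, .inp (.inr τ) => if ActiveAt F τ x ∧ nodeIndex F x ∈ D (F τ) then β else 0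
  | .out x, .collector S => if ActiveAt F T x ∧ nodeIndex F x ∈ S.1 then ⊤ else 0
  | _, _ => 0

/-- The minimum value of a cut `(U, Uᶜ)` separating the vertex `s` from the vertex `t`. -/
noncomputable def minCut {V : Type} [Fintype V] [DecidableEq V] (cap : V → V → ℝ≥0∞)
    (s t : V) : ℝ≥0∞ :=
  ⨅ U : {U : Finset V // s ∈ U ∧ t ∉ U}, ∑ u ∈ U.1, ∑ v ∈ U.1ᶜ, cap u v

/-- The minimum, over all information flow graphs of the scheme `D` (all finite failure histories)
and over all data collectors, of the min-cut value between the source and the data collector. -/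
noncomputable def schemeMinCut {n : ℕ} (k : ℕ) (D : Fin n → Finset (Fin n))
    (α β : ℝ≥0∞) : ℝ≥0∞ :=
  ⨅ (T : ℕ) (F : Fin T → Fin n) (S : {S : Finset (Fin n) // S.card = k}),
    minCut (capacity k D F α β) .source (.collector S)

/-- `(α, β)` is the minimum-bandwidth-regenerating point of the scheme `D` for file size `M`:
`β` is the least repair traffic for which the min-cut condition holds with `α = ∞`, and then
`α` is the least storage for which the min-cut condition holds with this `β`. -/
def IsMBRPoint {n : ℕ} (k : ℕ) (D : Fin n → Finset (Fin n)) (M α β : ℝ≥0) : Prop :=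
  IsLeast {b : ℝ≥0 | (M : ℝ≥0∞) ≤ schemeMinCut k D ⊤ b} β ∧
  IsLeast {a : ℝ≥0 | (M : ℝ≥0∞) ≤ schemeMinCut k D a β} α

/-! ### The family helper selection scheme -/

/-- The helper sets of the family helper selection scheme.  Node `i` lies in the family number
`i / (n - d)` (counted from `0`); the families with number below `n / (n - d)` are complete. -/
def fhsHelpers (n d : ℕ) (i : Fin n) : Finset (Fin n) :=
  if (i : ℕ) / (n - d) < n / (n - d) then
    Finset.univ.filter fun a => (a : ℕ) / (n - d) ≠ (i : ℕ) / (n - d)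
  else
    Finset.univ.filter fun a => (a : ℕ) < d

/-- The family index of the node at position `i` (counted from `0`).  Complete families have the
indices `1, …, c` with `c = n / (n - d)` and the incomplete family, if there is one, has index `0`;
in that case the members of family `c` that do not help the incomplete family have index `-c`. -/
def familyIndex (n d i : ℕ) : ℤ :=
  if n / (n - d) ≤ i / (n - d) then 0
  else if n % (n - d) ≠ 0 ∧ d ≤ i then -((n / (n - d) : ℕ) : ℤ)
  else ((i / (n - d) + 1 : ℕ) : ℤ)

/-- The family index vector. -/
def familyIndexVector (n d : ℕ) : List ℤ := (List.range n).map (familyIndex n d)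

/-- A family index permutation is a rearrangement of the family index vector. -/
def IsFamilyIndexPermutation (n d : ℕ) (π : List ℤ) : Prop := π.Perm (familyIndexVector n d)

/-- The rotating family index permutation: the family index vector is written column by column
into a table with `n - d` rows and `⌈n / (n - d)⌉` columns, which is then read row by row
(blank cells, with `col * (n - d) + row ≥ n`, are skipped). -/
def rotatingPermutation (n d : ℕ) : List ℤ :=
  (List.range (n - d)).flatMap fun row =>
    (List.range (n ⌈/⌉ (n - d))).filterMap fun col =>
      (familyIndexVector n d)[col * (n - d) + row]?

/-- `helpCount π i` is the number `y` attached to the coordinate of `π` at position `i`, where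
positions are counted from `0`. -/
def helpCount (π : List ℤ) (i : ℕ) : ℕ :=
  if π.getD i 0 = 0 then (π.take i).countP fun x => decide (0 < x)
  else (π.take i).countP fun x => decide (|x| ≠ |π.getD i 0|)

/-- The sum `∑ min((d - y_i(π)) β, α)` over the first `k` coordinates. -/
noncomputable def permutationCut (k d : ℕ) (α β : ℝ) (π : List ℤ) : ℝ :=
  ∑ i ∈ Finset.range k, min (((d : ℝ) - helpCount π i) * β) α

/-! ### Random access machines with logarithmic (bit) cost -/

/-- Instructions of a random access machine with registers `R 0, R 1, …` holding natural numbers;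
`dst`, `a`, `b`, `src` are register addresses. -/
inductive Instr : Type
  | const (dst v : ℕ)
  | add (dst a b : ℕ)
  | sub (dst a b : ℕ)
  | mul (dst a b : ℕ)
  | div (dst a b : ℕ)
  | load (dst a : ℕ)
  | store (a src : ℕ)
  | jumpIfZero (a target : ℕ)

/-- A machine configuration: program counter and register contents. -/
structure Config : Type where
  pc : ℕ
  reg : ℕ → ℕ

/-- The effect of one instruction: `sub` is truncated subtraction, `div` is integer division,
`load` and `store` are indirect. -/
def Instr.exec : Instr → Config → Config
  | .const dst v, s => ⟨s.pc + 1, Function.update s.reg dst v⟩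
  | .add dst a b, s => ⟨s.pc + 1, Function.update s.reg dst (s.reg a + s.reg b)⟩
  | .sub dst a b, s => ⟨s.pc + 1, Function.update s.reg dst (s.reg a - s.reg b)⟩
  | .mul dst a b, s => ⟨s.pc + 1, Function.update s.reg dst (s.reg a * s.reg b)⟩
  | .div dst a b, s => ⟨s.pc + 1, Function.update s.reg dst (s.reg a / s.reg b)⟩
  | .load dst a, s => ⟨s.pc + 1, Function.update s.reg dst (s.reg (s.reg a))⟩
  | .store a src, s => ⟨s.pc + 1, Function.update s.reg (s.reg a) (s.reg src)⟩
  | .jumpIfZero a target, s => ⟨if s.reg a = 0 then target else s.pc + 1, s.reg⟩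

/-- The number of bit operations charged for one instruction; multiplication and division are
charged the product of the operand lengths, everything else is linear in the operand lengths
(`Nat.size` is the length of the binary representation). -/
def Instr.cost : Instr → Config → ℕ
  | .const _ v, _ => 1 + v.size
  | .add _ a b, s => 1 + (s.reg a).size + (s.reg b).size
  | .sub _ a b, s => 1 + (s.reg a).size + (s.reg b).size
  | .mul _ a b, s => (1 + (s.reg a).size) * (1 + (s.reg b).size)
  | .div _ a b, s => (1 + (s.reg a).size) * (1 + (s.reg b).size)
  | .load _ a, s => 1 + (s.reg a).size + (s.reg (s.reg a)).size
  | .store a src, s => 1 + (s.reg a).size + (s.reg src).size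
  | .jumpIfZero a _, s => 1 + (s.reg a).size

/-- `HaltsIn P s t s'`: started in `s`, the program `P` halts in the configuration `s'` (whose
program counter points outside of `P`) after instructions of total cost `t`. -/
inductive HaltsIn (P : List Instr) : Config → ℕ → Config → Prop
  | halt (s : Config) (h : P[s.pc]? = none) : HaltsIn P s 0 s
  | step (s s' : Config) (t : ℕ) (c : Instr) (h : P[s.pc]? = some c)
      (h' : HaltsIn P (c.exec s) t s') : HaltsIn P s (c.cost s + t) s'

/-- The initial configuration: the input is in the first registers, all other registers are `0`. -/
def initConfig (input : List ℕ) : Config := ⟨0, fun r => input.getD r 0⟩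

end DistStorage

namespace DistStorage

/-! All three claims reduce to one extremal count. List nodes in some order and let each node count
its predecessors from other families. The total is the number of all pairs minus the number of pairs
inside one family, so it is largest when the family sizes are as equal as possible, subject to the
incomplete family having at most r members. Filling a table row by row achieves this for every
prefix length simultaneously: the i-th cell has exactly as many predecessors in its own column as
its row number. `sum_gridRow_le_sum_choose` is the balancing inequality and
`sum_card_ne_add_sum_gridRow_le` its complementary form.

For permutations, `helpCount` is at most the number of predecessors from other families, and the
rotating permutation attains the resulting bound on the sum. When α ≥ dβ the minimum never selects
α, so only the total help count matters.

For graphs, write S for `rotatingSum`. In any cut without infinite edges, take for each node its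
earliest instance whose output lies on the sink side. A helper of such an instance either sends β
across the cut or is itself a node with an earlier such instance, and it belongs to another family.
The same count then bounds every cut below by Sβ when α ≥ dβ (`rotatingSum_mul_le_minCut`). Failures
in rotating order give matching upper bounds (`schemeMinCut_le`): Sβ in general, and α + (S - d)β
when the first newcomer is cut at its storage. Hence β = M/S, and any smaller α than dβ fails.

For the computation, 2S has a closed form in additions, truncated subtractions, products and
quotients, so a program of fixed length without jumps suffices. -/

/-! ### The rotating arrangement and balanced family sizes -/

/-- Row of the `i`-th cell, in row-by-row reading, of a table with `c` long columns and one last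
column of height `r`. -/
def gridRow (c r i : ℕ) : ℕ :=
  if i < r * (c + 1) then i / (c + 1) else r + (i - r * (c + 1)) / c

/-- Column of the `i`-th cell, in row-by-row reading, of a table with `c` long columns and one last
column of height `r`. -/
def gridCol (c r i : ℕ) : ℕ :=
  if i < r * (c + 1) then i % (c + 1) else (i - r * (c + 1)) % c

/-- The first r rows have c + 1 cells and the later ones have c. All later facts about the table use
only these linear relations, not the div/mod definitions. -/
theorem grid_spec {c : ℕ} (hc : 0 < c) (r i : ℕ) :
    (gridRow c r i < r ∧ gridCol c r i ≤ c ∧ c * gridRow c r i + gridRow c r i + gridCol c r i = i) ∨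
    (r ≤ gridRow c r i ∧ gridCol c r i < c ∧ c * gridRow c r i + r + gridCol c r i = i) := by
  unfold gridRow gridCol
  split_ifs with h
  · left
    refine ⟨(Nat.div_lt_iff_lt_mul (Nat.succ_pos c)).2 h,
      Nat.lt_succ_iff.1 (Nat.mod_lt _ (Nat.succ_pos c)), ?_⟩
    have := Nat.div_add_mod i (c + 1)
    linarith
  · right
    refine ⟨Nat.le_add_right _ _, Nat.mod_lt _ hc, ?_⟩
    have := Nat.div_add_mod (i - r * (c + 1)) c
    have h' : i - r * (c + 1) + r * (c + 1) = i := Nat.sub_add_cancel (not_lt.1 h)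
    linarith

theorem gridRow_le {c : ℕ} (hc : 0 < c) (r i : ℕ) : gridRow c r i ≤ i := by
  have h1 : gridRow c r i ≤ c * gridRow c r i := Nat.le_mul_of_pos_left _ hc
  rcases grid_spec hc r i with ⟨_, _, h⟩ | ⟨_, _, h⟩ <;> omega

theorem gridRow_lt_of_gridCol_eq {c : ℕ} (hc : 0 < c) {r i j : ℕ} (hij : i < j)
    (h : gridCol c r i = gridCol c r j) : gridRow c r i < gridRow c r j := by
  by_contra! hle
  have := Nat.mul_le_mul_left c hle
  rcases grid_spec hc r i with ⟨_, _, h1⟩ | ⟨_, _, h1⟩ <;>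
  rcases grid_spec hc r j with ⟨_, _, h2⟩ | ⟨_, _, h2⟩ <;> omega

theorem gridRow_lt {c : ℕ} (hc : 0 < c) {r m i : ℕ} (hr : r ≤ m) (hi : i < c * m + r) :
    gridRow c r i < m := by
  by_contra! hle
  have := Nat.mul_le_mul_left c hle
  rcases grid_spec hc r i with ⟨_, _, h1⟩ | ⟨_, _, h1⟩ <;> omega

/-- The balancing inequality, by removing one node at a time: deleting a member from a family of
size b + 1 destroys b pairs, and some family has b at least the row of the last cell. -/
theorem sum_gridRow_le_sum_choose {c : ℕ} (hc : 0 < c) (r : ℕ) : ∀ (k : ℕ) (a : ℕ → ℕ),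
    a 0 ≤ r → ∑ f ∈ Finset.range (c + 1), a f = k →
    ∑ i ∈ Finset.range k, gridRow c r i ≤ ∑ f ∈ Finset.range (c + 1), (a f).choose 2 := by
  intro k
  induction k with
  | zero => simp
  | succ k ih =>
    intro a h0 hsum
    -- Pigeonhole: if every size were at most ρ, the row of cell k, the total would be at most cρ +
    -- min(ρ, r) ≤ k, but it is k + 1. The cap on `a 0` is needed here.
    obtain ⟨f, hf, hlt⟩ : ∃ f ∈ Finset.range (c + 1), gridRow c r k < a f := by
      by_contra! hall
      rw [Finset.sum_range_succ'] at hsum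
      have h1 : ∑ f ∈ Finset.range c, a (f + 1) ≤ c * gridRow c r k := by
        have := Finset.sum_le_card_nsmul (Finset.range c) (fun f => a (f + 1)) (gridRow c r k)
          (fun f hf => hall _ (by simpa using hf))
        simpa using this
      have h2 := hall 0 (by simp)
      rcases grid_spec hc r k with ⟨_, _, h⟩ | ⟨_, _, h⟩ <;> omega
    obtain ⟨b, hb⟩ : ∃ b, a f = b + 1 := ⟨a f - 1, by omega⟩
    have hupd : ∀ g : ℕ → ℕ, ∑ x ∈ (Finset.range (c + 1)).erase f, g (Function.update a f b x) =
        ∑ x ∈ (Finset.range (c + 1)).erase f, g (a x) := fun g =>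
      Finset.sum_congr rfl fun x hx => by
        rw [Function.update_of_ne (Finset.ne_of_mem_erase hx)]
    have hs1 := Finset.add_sum_erase _ a hf
    have hs2 := Finset.add_sum_erase _ (Function.update a f b) hf
    have hs3 := Finset.add_sum_erase _ (fun x => (a x).choose 2) hf
    have hs4 := Finset.add_sum_erase _ (fun x => (Function.update a f b x).choose 2) hf
    have e1 := hupd id
    have e2 := hupd (fun x => x.choose 2)
    simp only [id, Function.update_self] at e1 e2 hs1 hs2 hs3 hs4
    have hch : (a f).choose 2 = b + b.choose 2 := by
      rw [hb, Nat.choose_succ_succ' b 1, Nat.choose_one_right]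
    have := ih (Function.update a f b) (by
      by_cases h : f = 0
      · subst h; simp; omega
      · rwa [Function.update_of_ne (Ne.symm h)]) (by omega)
    rw [Finset.sum_range_succ]
    omega

/-- Both sides count pairs inside a class of `w`; on the left each pair is charged to its later
member. Inserting elements by increasing `key` leaves the earlier terms unchanged. -/
theorem sum_card_lt_eq_sum_choose {ι : Type*} (key w : ι → ℕ) (c : ℕ) (A : Finset ι)
    (hkey : Set.InjOn key A) (hw : ∀ x ∈ A, w x ≤ c) :
    ∑ x ∈ A, (A.filter fun y => key y < key x ∧ w y = w x).card =
      ∑ f ∈ Finset.range (c + 1), ((A.filter fun x => w x = f).card).choose 2 := by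
  classical
  induction A using Finset.induction_on_max_value key with
  | empty => simp
  | insert a s ha hmax ih =>
    have hlt : ∀ x ∈ s, key x < key a := fun x hx =>
      lt_of_le_of_ne (hmax x hx) fun h => ha (by
        rw [← hkey (by simp [hx]) (by simp) h]; exact hx)
    have hwa : w a ∈ Finset.range (c + 1) := by
      have := hw a (by simp); simp; omega
    rw [Finset.sum_insert ha]
    have h1 : (insert a s).filter (fun y => key y < key a ∧ w y = w a) =
        s.filter fun y => w y = w a := by
      ext y
      simp only [Finset.mem_filter, Finset.mem_insert]
      constructor
      · rintro ⟨rfl | h, h1, h2⟩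
        · omega
        · exact ⟨h, h2⟩
      · rintro ⟨h, h2⟩
        exact ⟨Or.inr h, hlt y h, h2⟩
    have h2 : ∀ x ∈ s, ((insert a s).filter fun y => key y < key x ∧ w y = w x).card =
        (s.filter fun y => key y < key x ∧ w y = w x).card := fun x hx => by
      rw [Finset.filter_insert, if_neg]
      have := hlt x hx
      omega
    rw [h1, Finset.sum_congr rfl h2, ih (hkey.mono (by simp)) fun x hx => hw x (by simp [hx]),
      ← Finset.add_sum_erase _ _ hwa, ← Finset.add_sum_erase _ _ hwa, ← add_assoc]
    congr 1
    · rw [Finset.filter_insert, if_pos rfl, Finset.card_insert_of_notMem (by simp [ha]),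
        Nat.choose_succ_succ' _ 1, Nat.choose_one_right]
    · refine Finset.sum_congr rfl fun f hf => ?_
      rw [Finset.filter_insert, if_neg (Finset.ne_of_mem_erase hf).symm]

/-- In any arrangement of nodes, the number of pairs from different families is at most the one
of the rotating arrangement. -/
theorem sum_card_ne_add_sum_gridRow_le {ι : Type*} (key w : ι → ℕ) {c r : ℕ} (hc : 0 < c)
    (A : Finset ι) (hkey : Set.InjOn key A) (hw : ∀ x ∈ A, w x ≤ c)
    (h0 : (A.filter fun x => w x = 0).card ≤ r) :
    ∑ x ∈ A, (A.filter fun y => key y < key x ∧ w y ≠ w x).card +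
      ∑ i ∈ Finset.range A.card, gridRow c r i ≤ ∑ i ∈ Finset.range A.card, i := by
  have h1 := sum_card_lt_eq_sum_choose key w c A hkey hw
  -- With a single class the lemma counts all pairs; the same-class pairs are then subtracted from
  -- this.
  have h2 := sum_card_lt_eq_sum_choose key (fun _ => 0) 0 A hkey (by simp)
  have h3 := sum_gridRow_le_sum_choose hc r A.card (fun f => (A.filter fun x => w x = f).card) h0
    (Finset.card_eq_sum_card_fiberwise fun x hx => by
      have := hw x hx; simp; omega).symm
  have h4 : ∑ x ∈ A, (A.filter fun y => key y < key x).card =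
      ∑ x ∈ A, (A.filter fun y => key y < key x ∧ w y = w x).card +
      ∑ x ∈ A, (A.filter fun y => key y < key x ∧ w y ≠ w x).card := by
    rw [← Finset.sum_add_distrib]
    refine Finset.sum_congr rfl fun x _ => ?_
    rw [← Finset.card_filter_add_card_filter_not (s := A.filter fun y => key y < key x)
      (fun y => w y = w x), Finset.filter_filter, Finset.filter_filter]
  have h5 : ∑ i ∈ Finset.range A.card, i = A.card.choose 2 := by
    rw [Finset.sum_range_id, Nat.choose_two_right]
  simp at h2
  omega

/-! ### The rotating family index permutation -/

/-- The node at position `i` of the rotating arrangement. -/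
def rotatingNode (n d i : ℕ) : ℕ :=
  gridCol (n / (n - d)) (n % (n - d)) i * (n - d) + gridRow (n / (n - d)) (n % (n - d)) i

/-- The number of the family of node `i`, where the incomplete family has number `0`. -/
def family (n d i : ℕ) : ℕ := (familyIndex n d i).natAbs

theorem family_size_pos {n d : ℕ} (hd : d < n) : 0 < n - d := Nat.sub_pos_of_lt hd

theorem families_pos {n d : ℕ} (hd : d < n) : 0 < n / (n - d) :=
  Nat.div_pos (Nat.sub_le _ _) (family_size_pos hd)

/-- The absolute value merges the indices c and -c: a node i ≥ d satisfies i + (n - d) ≥ n, so it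
lies in the last complete family or beyond it. -/
theorem family_eq {n d : ℕ} (hd : d < n) (i : ℕ) :
    family n d i = if i / (n - d) < n / (n - d) then i / (n - d) + 1 else 0 := by
  have hm := family_size_pos hd
  have h1 : d ≤ i → n / (n - d) ≤ i / (n - d) + 1 := fun h => by
    rw [← Nat.add_div_right _ hm]
    exact Nat.div_le_div_right (by omega)
  unfold family familyIndex
  generalize n / (n - d) = c at *
  generalize i / (n - d) = q at *
  split_ifs <;> omega

theorem family_le {n d : ℕ} (hd : d < n) (i : ℕ) : family n d i ≤ n / (n - d) := by
  rw [family_eq hd]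
  generalize n / (n - d) = c at *
  generalize i / (n - d) = q at *
  split_ifs <;> omega

theorem card_family_eq_zero {n d : ℕ} (hd : d < n) :
    ((Finset.range n).filter fun i => family n d i = 0).card = n % (n - d) := by
  have hm := family_size_pos hd
  have : ((Finset.range n).filter fun i => family n d i = 0) =
      Finset.Ico (n / (n - d) * (n - d)) n := by
    ext i
    have := Nat.le_div_iff_mul_le hm (x := n / (n - d)) (y := i)
    simp only [Finset.mem_filter, Finset.mem_range, Finset.mem_Ico, family_eq hd]
    rw [← this]
    clear this
    generalize n / (n - d) = c at *
    generalize i / (n - d) = q at *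
    by_cases h : q < c
    · simp [h]
    · simp [h, not_lt.1 h]
  rw [this, Nat.card_Ico]
  have := Nat.div_add_mod' n (n - d)
  omega

theorem gridRow_lt_family_size {n d i : ℕ} (hd : d < n) (hi : i < n) :
    gridRow (n / (n - d)) (n % (n - d)) i < n - d :=
  gridRow_lt (families_pos hd) (Nat.mod_lt _ (family_size_pos hd)).le
    (by rwa [Nat.div_add_mod'])

theorem rotatingNode_div {n d i : ℕ} (hd : d < n) (hi : i < n) :
    rotatingNode n d i / (n - d) = gridCol (n / (n - d)) (n % (n - d)) i := by
  rw [rotatingNode, Nat.add_comm, Nat.add_mul_div_right _ _ (family_size_pos hd),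
    Nat.div_eq_of_lt (gridRow_lt_family_size hd hi), Nat.zero_add]

theorem rotatingNode_lt {n d i : ℕ} (hd : d < n) (hi : i < n) : rotatingNode n d i < n := by
  have h1 := gridRow_lt_family_size hd hi
  have h2 := Nat.div_add_mod' n (n - d)
  unfold rotatingNode
  rcases grid_spec (families_pos hd) (n % (n - d)) i with ⟨h, h', _⟩ | ⟨_, h, _⟩
  · have := Nat.mul_le_mul_right (n - d) h'
    omega
  · have := Nat.mul_le_mul_right (n - d) (Nat.succ_le_of_lt h)
    rw [Nat.succ_mul] at this
    omega

theorem rotatingNode_injOn {n d : ℕ} (hd : d < n) : Set.InjOn (rotatingNode n d) {i | i < n} := by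
  intro i hi j hj h
  have h1 : gridCol (n / (n - d)) (n % (n - d)) i = gridCol (n / (n - d)) (n % (n - d)) j := by
    rw [← rotatingNode_div hd hi, ← rotatingNode_div hd hj, h]
  rcases lt_trichotomy i j with hij | hij | hij
  · have := gridRow_lt_of_gridCol_eq (families_pos hd) hij h1
    unfold rotatingNode at h
    rw [h1] at h
    omega
  · exact hij
  · have := gridRow_lt_of_gridCol_eq (families_pos hd) hij h1.symm
    unfold rotatingNode at h
    rw [h1] at h
    omega

/-- All nodes of complete families that precede a node of the incomplete family in the rotating
arrangement are helpers of it. -/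
theorem rotatingNode_lt_of_gridCol_eq {n d i j : ℕ} (hd : d < n) (hji : j < i)
    (hi : gridCol (n / (n - d)) (n % (n - d)) i = n / (n - d))
    (hj : gridCol (n / (n - d)) (n % (n - d)) j ≠ n / (n - d)) : rotatingNode n d j < d := by
  have hc := families_pos hd
  have h2 := Nat.div_add_mod' n (n - d)
  unfold rotatingNode
  generalize n % (n - d) = r at *
  generalize n / (n - d) = c at *
  -- The last column has cells only in the first r rows, so a cell j before i is in those rows too.
  -- Its node number is then below (c - 1)(n - d) + r = d.
  have hrow : gridRow c r j < r ∧ gridCol c r j < c := by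
    rcases grid_spec hc r j with ⟨h3, h4, h5⟩ | ⟨h3, h4, h5⟩
    · omega
    · exfalso
      have := Nat.mul_le_mul_left c h3
      rcases grid_spec hc r i with ⟨h6, h7, h8⟩ | ⟨h6, h7, h8⟩
      · have := Nat.mul_le_mul_left c (Nat.succ_le_of_lt h6)
        rw [Nat.mul_succ] at this
        omega
      · omega
  have := Nat.mul_le_mul_right (n - d) (Nat.succ_le_of_lt hrow.2)
  rw [Nat.succ_mul] at this
  omega

/-! ### Reading the table row by row as one map over positions. -/

theorem filterMap_range_eq_map {β : Type*} (g : ℕ → β) (f : ℕ → Option β) {w N : ℕ} (h : w ≤ N)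
    (h1 : ∀ i < w, f i = some (g i)) (h2 : ∀ i, w ≤ i → f i = none) :
    (List.range N).filterMap f = (List.range w).map g := by
  obtain ⟨b, rfl⟩ := Nat.exists_eq_add_of_le h
  rw [List.range_add, List.filterMap_append]
  have e1 : (List.range w).filterMap f = (List.range w).filterMap (fun i => some (g i)) :=
    List.filterMap_congr fun i hi => h1 i (by simpa using hi)
  have e2 : ((List.range b).map (w + ·)).filterMap f = [] := by
    rw [List.filterMap_eq_nil_iff]
    intro i hi
    simp only [List.mem_map] at hi
    obtain ⟨x, _, rfl⟩ := hi
    exact h2 _ (Nat.le_add_right _ _)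
  rw [e1, e2, List.append_nil, ← List.filterMap_eq_map]
  rfl

theorem flatMap_range_map_range {β : Type*} (g : ℕ → ℕ → β) {b : ℕ} (hb : 0 < b) (a : ℕ) :
    (List.range a).flatMap (fun x => (List.range b).map (g x)) =
      (List.range (a * b)).map fun i => g (i / b) (i % b) := by
  induction a with
  | zero => simp
  | succ a ih =>
    rw [List.range_succ, List.flatMap_append, ih, Nat.succ_mul, List.range_add, List.map_append,
      List.map_map]
    congr 1
    simp only [List.flatMap_cons, List.flatMap_nil, List.append_nil]
    refine List.map_congr_left fun x hx => ?_
    have hx : x < b := by simpa using hx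
    simp only [Function.comp]
    rw [Nat.add_comm, Nat.add_mul_div_right _ _ hb, Nat.div_eq_of_lt hx, Nat.zero_add,
      Nat.add_mul_mod_self_right, Nat.mod_eq_of_lt hx]

theorem rotatingPermutation_eq_map {n d : ℕ} (hd : d < n) :
    rotatingPermutation n d =
      (List.range n).map fun i => familyIndex n d (rotatingNode n d i) := by
  have hm := family_size_pos hd
  have hc := families_pos hd
  have hr : n % (n - d) < n - d := Nat.mod_lt _ hm
  have hn := Nat.div_add_mod' n (n - d)
  have hceil : n ⌈/⌉ (n - d) = if 0 < n % (n - d) then n / (n - d) + 1 else n / (n - d) := by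
    rw [Nat.ceilDiv_eq_add_pred_div]
    generalize n - d = m at *
    generalize hr' : n % m = r at *
    generalize n / m = c at *
    rw [Nat.div_eq_iff hm]
    split_ifs
    · rw [Nat.succ_mul]; omega
    · omega
  have hrow : ∀ row < n - d, (List.range (n ⌈/⌉ (n - d))).filterMap
      (fun col => (familyIndexVector n d)[col * (n - d) + row]?) =
      (List.range (if row < n % (n - d) then n / (n - d) + 1 else n / (n - d))).map
        fun col => familyIndex n d (col * (n - d) + row) := by
    intro row hrow
    refine filterMap_range_eq_map _ _ ?_ ?_ ?_
    · rw [hceil]; split_ifs <;> omega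
    · intro i hi
      have : i * (n - d) + row < n := by
        split_ifs at hi
        · have := Nat.mul_le_mul_right (n - d) (Nat.lt_succ_iff.1 hi)
          omega
        · have := Nat.mul_le_mul_right (n - d) (Nat.succ_le_of_lt hi)
          rw [Nat.succ_mul] at this
          omega
      simp [familyIndexVector, this]
    · intro i hi
      have : n ≤ i * (n - d) + row := by
        have := Nat.mul_le_mul_right (n - d) hi
        split_ifs at this
        · rw [Nat.succ_mul] at this
          omega
        · omega
      simp [familyIndexVector, this]
  -- The cells are counted by rows: r rows of width c + 1 and n - d - r rows of width c. Both lists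
  -- are split at this boundary, so each block has constant width.
  have hlen : n = n % (n - d) * (n / (n - d) + 1) + (n - d - n % (n - d)) * (n / (n - d)) := by
    conv_lhs => rw [← hn]
    obtain ⟨e, he⟩ := Nat.exists_eq_add_of_lt hr
    generalize n / (n - d) = c
    generalize n % (n - d) = r at *
    rw [he]
    have : r + e + 1 - r = e + 1 := by omega
    rw [this]
    ring
  unfold rotatingPermutation
  have h1 : (List.range (n - d)).flatMap (fun row => (List.range (n ⌈/⌉ (n - d))).filterMap
      fun col => (familyIndexVector n d)[col * (n - d) + row]?) =
      (List.range (n - d)).flatMap (fun row =>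
        (List.range (if row < n % (n - d) then n / (n - d) + 1 else n / (n - d))).map
        fun col => familyIndex n d (col * (n - d) + row)) := by
    rw [List.flatMap_def, List.flatMap_def]
    congr 1
    exact List.map_congr_left fun row h => hrow row (by simpa using h)
  have h2 : List.range (n - d) = List.range (n % (n - d)) ++
      (List.range (n - d - n % (n - d))).map (n % (n - d) + ·) := by
    rw [← List.range_add, Nat.add_sub_cancel' hr.le]
  rw [h1, h2, List.flatMap_append, List.flatMap_map]
  have h3 : List.range n = List.range (n % (n - d) * (n / (n - d) + 1)) ++
      (List.range ((n - d - n % (n - d)) * (n / (n - d)))).map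
        (n % (n - d) * (n / (n - d) + 1) + ·) := by
    rw [← List.range_add, ← hlen]
  rw [h3, List.map_append, List.map_map]
  congr 1
  · rw [List.map_congr_left (g := fun i => familyIndex n d
      (i % (n / (n - d) + 1) * (n - d) + i / (n / (n - d) + 1))),
      ← flatMap_range_map_range (fun row col => familyIndex n d (col * (n - d) + row))
      (Nat.succ_pos _), List.flatMap_def, List.flatMap_def]
    · congr 1
      refine List.map_congr_left fun row h => ?_
      rw [if_pos (by simpa using h)]
    · intro i hi
      rw [List.mem_range] at hi
      rw [rotatingNode, gridRow, gridCol, if_pos hi, if_pos hi]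
  · rw [List.map_congr_left (g := fun i => familyIndex n d
      (i % (n / (n - d)) * (n - d) + (n % (n - d) + i / (n / (n - d))))),
      ← flatMap_range_map_range
      (fun row col => familyIndex n d (col * (n - d) + (n % (n - d) + row))) hc,
      List.flatMap_def, List.flatMap_def]
    · congr 1
      refine List.map_congr_left fun row h => ?_
      rw [if_neg (by omega)]
    · intro i hi
      simp only [Function.comp]
      rw [rotatingNode, gridRow, gridCol, if_neg (by omega), if_neg (by omega),
        Nat.add_sub_cancel_left]

theorem isFamilyIndexPermutation_rotatingPermutation {n d : ℕ} (hd : d < n) :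
    IsFamilyIndexPermutation n d (rotatingPermutation n d) := by
  have h : ((List.range n).map (rotatingNode n d)).Perm (List.range n) := by
    refine List.Subperm.perm_of_length_le (List.subperm_of_subset ?_ ?_) (by simp)
    · refine List.Nodup.map_on ?_ List.nodup_range
      intro x hx y hy h
      exact rotatingNode_injOn hd (by simpa using hx) (by simpa using hy) h
    · intro x hx
      simp only [List.mem_map, List.mem_range] at hx ⊢
      obtain ⟨i, hi, rfl⟩ := hx
      exact rotatingNode_lt hd hi
  have := h.map (familyIndex n d)
  rw [List.map_map] at this
  rw [IsFamilyIndexPermutation, rotatingPermutation_eq_map hd]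
  exact this

/-! ### Help counts and optimality of the rotating permutation. -/

theorem countP_range_eq_card (p : ℕ → Bool) (i : ℕ) :
    (List.range i).countP p = ((Finset.range i).filter fun j => p j = true).card := by
  rw [List.countP_eq_length_filter]
  simp [Finset.card, Finset.filter, Finset.range, Multiset.range]

theorem take_eq_map_getD (π : List ℤ) {i : ℕ} (hi : i ≤ π.length) :
    π.take i = (List.range i).map fun j => π.getD j 0 := by
  refine List.ext_getElem (by simp [hi]) fun j h1 h2 => ?_
  have : j < π.length := by simp at h1; omega
  simp [this]

theorem helpCount_eq (π : List ℤ) {i : ℕ} (hi : i ≤ π.length) :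
    helpCount π i = if π.getD i 0 = 0 then
      ((Finset.range i).filter fun j => 0 < π.getD j 0).card else
      ((Finset.range i).filter fun j => (π.getD j 0).natAbs ≠ (π.getD i 0).natAbs).card := by
  unfold helpCount
  rw [take_eq_map_getD π hi, List.countP_map, List.countP_map, countP_range_eq_card,
    countP_range_eq_card]
  split_ifs
  · simp
  · congr 1
    refine Finset.filter_congr fun j _ => ?_
    simp only [Function.comp, decide_eq_true_eq, ne_eq, Int.abs_eq_natAbs, Nat.cast_inj]

/-- The inequality can be strict only at a coordinate 0, where predecessors of index -c belong to
another family but are not counted. -/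
theorem helpCount_le (π : List ℤ) {i : ℕ} (hi : i ≤ π.length) : helpCount π i ≤
    ((Finset.range i).filter fun j => (π.getD j 0).natAbs ≠ (π.getD i 0).natAbs).card := by
  rw [helpCount_eq π hi]
  split_ifs with h
  · refine Finset.card_le_card fun j hj => ?_
    simp only [Finset.mem_filter] at hj ⊢
    exact ⟨hj.1, by omega⟩
  · exact le_rfl

theorem sum_helpCount_add_sum_gridRow_le {n d k : ℕ} (hd : d < n) (hk : k ≤ n) {π : List ℤ}
    (hπ : IsFamilyIndexPermutation n d π) :
    ∑ i ∈ Finset.range k, helpCount π i +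
      ∑ i ∈ Finset.range k, gridRow (n / (n - d)) (n % (n - d)) i ≤
      ∑ i ∈ Finset.range k, i := by
  have hlen : π.length = n := by rw [List.Perm.length_eq hπ]; simp [familyIndexVector]
  have key := sum_card_ne_add_sum_gridRow_le (fun i : ℕ => i) (fun i => (π.getD i 0).natAbs)
    (r := n % (n - d)) (families_pos hd) (Finset.range k) (fun _ _ _ _ h => h) (by
      intro x hx
      have hx : x < π.length := by rw [Finset.mem_range] at hx; omega
      have hmem : π.getD x 0 ∈ familyIndexVector n d := by
        rw [← List.Perm.mem_iff hπ]
        simp [hx]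
      obtain ⟨y, -, hy⟩ := List.mem_map.1 hmem
      rw [← hy]
      exact family_le hd y) (by
      have h1 : ((Finset.range k).filter fun x => (π.getD x 0).natAbs = 0).card =
          (π.take k).countP fun x => decide (x.natAbs = 0) := by
        rw [take_eq_map_getD π (hlen ▸ hk), List.countP_map, countP_range_eq_card]
        simp
      have h2 : (familyIndexVector n d).countP (fun x => decide (x.natAbs = 0)) =
          n % (n - d) := by
        rw [familyIndexVector, List.countP_map, countP_range_eq_card, ← card_family_eq_zero hd]
        simp [family]
      rw [h1, ← h2, ← List.Perm.countP_eq _ hπ]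
      exact (List.take_sublist k π).countP_le)
  rw [Finset.card_range] at key
  refine le_trans (Nat.add_le_add_right (Finset.sum_le_sum fun i hi => ?_) _) key
  rw [Finset.mem_range] at hi
  refine (helpCount_le π (by omega)).trans (Finset.card_le_card fun j hj => ?_)
  simp only [Finset.mem_filter, Finset.mem_range] at hj ⊢
  exact ⟨by omega, hj.1, hj.2⟩

theorem card_gridCol_eq_le {c : ℕ} (hc : 0 < c) (r i : ℕ) :
    ((Finset.range i).filter fun j => gridCol c r j = gridCol c r i).card ≤ gridRow c r i := by
  rw [← Finset.card_range (gridRow c r i)]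
  refine Finset.card_le_card_of_injOn (gridRow c r) ?_ ?_
  · intro j hj
    simp only [Finset.coe_filter, Finset.mem_range, Set.mem_ofPred_eq, Finset.coe_range,
      Set.mem_Iio] at hj ⊢
    exact gridRow_lt_of_gridCol_eq hc hj.1 hj.2
  · intro j hj l hl h
    simp only [Finset.coe_filter, Finset.mem_range, Set.mem_ofPred_eq] at hj hl
    rcases lt_trichotomy j l with hjl | hjl | hjl
    · exact absurd h (gridRow_lt_of_gridCol_eq hc hjl (hj.2.trans hl.2.symm)).ne
    · exact hjl
    · exact absurd h (gridRow_lt_of_gridCol_eq hc hjl (hl.2.trans hj.2.symm)).ne'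

theorem le_card_gridCol_ne_add_gridRow {c : ℕ} (hc : 0 < c) (r i : ℕ) :
    i ≤ ((Finset.range i).filter fun j => gridCol c r j ≠ gridCol c r i).card +
      gridRow c r i := by
  have h1 := card_gridCol_eq_le hc r i
  have h2 := Finset.card_filter_add_card_filter_not (s := Finset.range i)
    (fun j => gridCol c r j = gridCol c r i)
  rw [Finset.card_range] at h2
  simp only [ne_eq]
  omega

theorem family_rotatingNode {n d i : ℕ} (hd : d < n) (hi : i < n) :
    family n d (rotatingNode n d i) =
      if gridCol (n / (n - d)) (n % (n - d)) i < n / (n - d) then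
        gridCol (n / (n - d)) (n % (n - d)) i + 1 else 0 := by
  rw [family_eq hd, rotatingNode_div hd hi]

theorem gridCol_le {c : ℕ} (hc : 0 < c) (r i : ℕ) : gridCol c r i ≤ c := by
  rcases grid_spec hc r i with ⟨_, h, _⟩ | ⟨_, h, _⟩ <;> omega

theorem family_rotatingNode_ne {n d i j : ℕ} (hd : d < n) (hi : i < n) (hj : j < n)
    (h : gridCol (n / (n - d)) (n % (n - d)) j ≠ gridCol (n / (n - d)) (n % (n - d)) i) :
    family n d (rotatingNode n d j) ≠ family n d (rotatingNode n d i) := by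
  have h1 := gridCol_le (families_pos hd) (n % (n - d)) i
  have h2 := gridCol_le (families_pos hd) (n % (n - d)) j
  rw [family_rotatingNode hd hi, family_rotatingNode hd hj]
  generalize n / (n - d) = c at *
  split_ifs <;> omega

/-- The reverse, coordinatewise estimate for the rotating permutation. No index -c precedes a 0
there, by `rotatingNode_lt_of_gridCol_eq`, so nothing is lost in `helpCount_le`. -/
theorem le_helpCount_add_gridRow {n d i : ℕ} (hd : d < n) (hi : i < n) :
    i ≤ helpCount (rotatingPermutation n d) i + gridRow (n / (n - d)) (n % (n - d)) i := by
  have hc := families_pos hd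
  refine (le_card_gridCol_ne_add_gridRow hc (n % (n - d)) i).trans (Nat.add_le_add_right ?_ _)
  have hget : ∀ j < n, (rotatingPermutation n d).getD j 0 =
      familyIndex n d (rotatingNode n d j) := fun j hj => by
    rw [rotatingPermutation_eq_map hd]
    simp [hj]
  rw [helpCount_eq _ (by rw [rotatingPermutation_eq_map hd]; simpa using hi.le), hget i hi]
  split_ifs with h0
  · have hi0 := family_rotatingNode hd hi
    rw [family, h0, Int.natAbs_zero] at hi0
    have hci := gridCol_le hc (n % (n - d)) i
    have hci' : gridCol (n / (n - d)) (n % (n - d)) i = n / (n - d) := by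
      generalize n / (n - d) = c at *
      split_ifs at hi0
      omega
    refine Finset.card_le_card fun j hj => ?_
    simp only [Finset.mem_filter, Finset.mem_range] at hj ⊢
    refine ⟨hj.1, ?_⟩
    rw [hget j (hj.1.trans hi)]
    have hlt := rotatingNode_lt_of_gridCol_eq hd hj.1 hci' (fun h => hj.2 (h.trans hci'.symm))
    have hne := family_rotatingNode_ne hd hi (hj.1.trans hi) hj.2
    have hne : familyIndex n d (rotatingNode n d j) ≠ 0 := fun h => hne (by
      rw [family, family, h, h0])
    revert hne
    unfold familyIndex
    split_ifs with h1 h2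
    · exact fun h => absurd rfl h
    · exact absurd h2.2 hlt.not_ge
    · intro _
      positivity
  · refine Finset.card_le_card fun j hj => ?_
    simp only [Finset.mem_filter, Finset.mem_range] at hj ⊢
    refine ⟨hj.1, ?_⟩
    rw [hget j (hj.1.trans hi)]
    exact family_rotatingNode_ne hd hi (hj.1.trans hi) hj.2

theorem sum_helpCount_rotatingPermutation {n d k : ℕ} (hd : d < n) (hk : k ≤ n) :
    ∑ i ∈ Finset.range k, helpCount (rotatingPermutation n d) i +
      ∑ i ∈ Finset.range k, gridRow (n / (n - d)) (n % (n - d)) i =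
      ∑ i ∈ Finset.range k, i := by
  refine le_antisymm (sum_helpCount_add_sum_gridRow_le hd hk
    (isFamilyIndexPermutation_rotatingPermutation hd)) ?_
  rw [← Finset.sum_add_distrib]
  exact Finset.sum_le_sum fun i hi =>
    le_helpCount_add_gridRow hd ((Finset.mem_range.1 hi).trans_le hk)

/-- Makes the truncated subtraction in `rotatingSum` exact. It follows from d = (c - 1)(n - d) + r
and the row being less than n - d. -/
theorem le_add_gridRow {n d i : ℕ} (hd : d < n) (hi : i < n) :
    i ≤ d + gridRow (n / (n - d)) (n % (n - d)) i := by
  have hc := families_pos hd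
  have hrow := gridRow_lt_family_size hd hi
  have hn := Nat.div_add_mod' n (n - d)
  have hs := grid_spec hc (n % (n - d)) i
  generalize gridRow (n / (n - d)) (n % (n - d)) i = ρ at *
  generalize gridCol (n / (n - d)) (n % (n - d)) i = κ at *
  generalize n % (n - d) = r at *
  generalize n / (n - d) = c at *
  obtain ⟨c, rfl⟩ := Nat.exists_eq_add_of_lt hc
  have := Nat.mul_le_mul_left c (Nat.succ_le_of_lt hrow)
  rw [Nat.mul_succ] at this
  simp only [Nat.zero_add, Nat.add_mul, Nat.one_mul] at *
  omega

/-- The sum of the differences `d - y_i` over the first `k` coordinates of the rotating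
permutation. -/
def rotatingSum (n k d : ℕ) : ℕ :=
  ∑ i ∈ Finset.range k, (d + gridRow (n / (n - d)) (n % (n - d)) i - i)

theorem rotatingSum_add_sum {n k d : ℕ} (hd : d < n) (hk : k ≤ n) :
    rotatingSum n k d + ∑ i ∈ Finset.range k, i =
      k * d + ∑ i ∈ Finset.range k, gridRow (n / (n - d)) (n % (n - d)) i := by
  have h : ∀ i ∈ Finset.range k, d + gridRow (n / (n - d)) (n % (n - d)) i - i + i =
      d + gridRow (n / (n - d)) (n % (n - d)) i := fun i hi =>
    Nat.sub_add_cancel (le_add_gridRow hd ((Finset.mem_range.1 hi).trans_le hk))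
  rw [rotatingSum, ← Finset.sum_add_distrib, Finset.sum_congr rfl h, Finset.sum_add_distrib]
  simp

theorem le_rotatingSum {n k d : ℕ} (hk : 0 < k) : d ≤ rotatingSum n k d := by
  have := Finset.single_le_sum (f := fun i =>
    d + gridRow (n / (n - d)) (n % (n - d)) i - i) (fun _ _ => Nat.zero_le _)
    (Finset.mem_range.2 hk)
  exact le_trans (by simp) this

theorem rotatingSum_mono {n k l d : ℕ} (h : k ≤ l) : rotatingSum n k d ≤ rotatingSum n l d :=
  Finset.sum_le_sum_of_subset (Finset.range_subset_range.2 h)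

theorem sum_sub_helpCount_rotatingPermutation {n k d : ℕ} (hd : d < n) (hk : k ≤ n) :
    ∑ i ∈ Finset.range k, ((d : ℝ) - helpCount (rotatingPermutation n d) i) =
      rotatingSum n k d := by
  have h1 := sum_helpCount_rotatingPermutation hd hk
  have h2 := rotatingSum_add_sum hd hk
  rw [Finset.sum_sub_distrib]
  simp only [Finset.sum_const, Finset.card_range, nsmul_eq_mul]
  have h3 : rotatingSum n k d + ∑ i ∈ Finset.range k, helpCount (rotatingPermutation n d) i =
    k * d := by omega
  rw [sub_eq_iff_eq_add]
  exact_mod_cast h3.symm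

theorem permutationCut_rotatingPermutation_le {n k d : ℕ} (hd : d < n) (hk : k ≤ n) {α β : ℝ}
    (hβ : 0 ≤ β) (hα : d * β ≤ α) {π : List ℤ} (hπ : IsFamilyIndexPermutation n d π) :
    permutationCut k d α β (rotatingPermutation n d) ≤ permutationCut k d α β π := by
  have h : ∀ π : List ℤ, permutationCut k d α β π =
      (k * d - (∑ i ∈ Finset.range k, helpCount π i : ℕ)) * β := fun π => by
    have : ∀ i ∈ Finset.range k, min (((d : ℝ) - helpCount π i) * β) α =
        ((d : ℝ) - helpCount π i) * β := fun i _ =>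
      min_eq_left (le_trans (mul_le_mul_of_nonneg_right (by simp) hβ) hα)
    rw [permutationCut, Finset.sum_congr rfl this, ← Finset.sum_mul, Finset.sum_sub_distrib]
    simp
  rw [h, h]
  have h1 := sum_helpCount_add_sum_gridRow_le hd hk hπ
  have h2 := sum_helpCount_rotatingPermutation hd hk
  have h3 : ∑ i ∈ Finset.range k, helpCount π i ≤
    ∑ i ∈ Finset.range k, helpCount (rotatingPermutation n d) i := by omega
  have h4 : ((∑ i ∈ Finset.range k, helpCount π i : ℕ) : ℝ) ≤
    (∑ i ∈ Finset.range k, helpCount (rotatingPermutation n d) i : ℕ) := by exact_mod_cast h3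
  exact mul_le_mul_of_nonneg_right (by linarith) hβ

/-! ### Minimum cuts of the information flow graphs -/

theorem card_filter_fin (n : ℕ) (p : ℕ → Prop) [DecidablePred p] :
    ((Finset.univ : Finset (Fin n)).filter fun a : Fin n => p a).card =
      ((Finset.range n).filter p).card := by
  rw [Finset.card_filter, Finset.card_filter,
    Fin.sum_univ_eq_sum_range (fun i => if p i then 1 else 0)]

theorem card_fhsHelpers {n d : ℕ} (hd : d < n) (i : Fin n) : (fhsHelpers n d i).card = d := by
  have hm := family_size_pos hd
  unfold fhsHelpers
  split_ifs with h
  · rw [card_filter_fin n fun a => a / (n - d) ≠ (i : ℕ) / (n - d)]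
    generalize (i : ℕ) / (n - d) = q at *
    have h1 := Finset.card_filter_add_card_filter_not (s := Finset.range n)
      (fun a => a / (n - d) = q)
    have hq : q * (n - d) + (n - d) ≤ n := by
      rw [← Nat.succ_mul]
      exact (Nat.le_div_iff_mul_le hm).1 h
    have h2 : (Finset.range n).filter (fun a => a / (n - d) = q) =
        Finset.Ico (q * (n - d)) (q * (n - d) + (n - d)) := by
      ext a
      simp only [Finset.mem_filter, Finset.mem_range, Finset.mem_Ico]
      rw [Nat.div_eq_iff hm]
      omega
    rw [h2, Nat.card_Ico, Finset.card_range] at h1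
    simp only [ne_eq]
    omega
  · rw [card_filter_fin n fun a => a < d]
    have : (Finset.range n).filter (fun a => a < d) = Finset.range d := by
      ext a
      simp only [Finset.mem_filter, Finset.mem_range]
      omega
    rw [this, Finset.card_range]

theorem family_ne_of_mem_fhsHelpers {n d : ℕ} (hd : d < n) {a i : Fin n}
    (h : a ∈ fhsHelpers n d i) : family n d a ≠ family n d i := by
  have hm := family_size_pos hd
  have hn := Nat.div_add_mod' n (n - d)
  have hr := Nat.mod_lt n hm
  have h3 := Nat.div_lt_iff_lt_mul hm (x := a) (y := n / (n - d))
  rw [family_eq hd, family_eq hd]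
  unfold fhsHelpers at h
  split_ifs at h with h1
  · rw [Finset.mem_filter] at h
    have h4 := h.2
    rw [if_pos h1]
    split_ifs
    · exact fun h5 => h4 (Nat.succ_injective h5)
    · exact (Nat.succ_ne_zero _).symm
  · rw [Finset.mem_filter] at h
    rw [if_neg h1, if_pos]
    · exact Nat.succ_ne_zero _
    · rw [h3]
      have := Nat.le_mul_of_pos_left (n - d) (families_pos hd)
      omega

theorem rotatingNode_mem_fhsHelpers {n d i j : ℕ} (hd : d < n) (hi : i < n) (hj : j < i)
    (h : gridCol (n / (n - d)) (n % (n - d)) j ≠ gridCol (n / (n - d)) (n % (n - d)) i) :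
    (⟨rotatingNode n d j, rotatingNode_lt hd (hj.trans hi)⟩ : Fin n) ∈
      fhsHelpers n d ⟨rotatingNode n d i, rotatingNode_lt hd hi⟩ := by
  have hc := gridCol_le (families_pos hd) (n % (n - d)) i
  unfold fhsHelpers
  simp only [rotatingNode_div hd hi]
  split_ifs with h1
  · simpa [rotatingNode_div hd (hj.trans hi)] using h
  · have : gridCol (n / (n - d)) (n % (n - d)) i = n / (n - d) :=
      le_antisymm hc (not_lt.1 h1)
    simp only [Finset.mem_filter, Finset.mem_univ, true_and]
    exact rotatingNode_lt_of_gridCol_eq hd hj this (fun h' => h (h'.trans this.symm))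

theorem exists_activeAt {n T : ℕ} (F : Fin T → Fin n) (τ : ℕ) (a : Fin n) :
    ∃ x, ActiveAt F τ x ∧ nodeIndex F x = a := by
  classical
  by_cases h : ((Finset.univ : Finset (Fin T)).filter fun ρ : Fin T => (ρ : ℕ) < τ ∧ F ρ = a).Nonempty
  · obtain ⟨σ, hσ, hmax⟩ := Finset.exists_max_image _ id h
    simp only [Finset.mem_filter, Finset.mem_univ, true_and, id] at hσ hmax
    refine ⟨.inr σ, ⟨hσ.1, fun ρ h1 h2 h3 => ?_⟩, hσ.2⟩
    have := hmax ρ ⟨h2, h3.trans hσ.2⟩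
    rw [Fin.le_def] at this
    omega
  · refine ⟨.inl a, fun ρ h1 h2 => h ⟨ρ, ?_⟩, rfl⟩
    simp [h1, h2]

/-- The creation order of storage-node instances. -/
def instanceRank {n T : ℕ} : Instance n T → ℕ
  | .inl i => i
  | .inr σ => n + σ

theorem instanceRank_injective {n T : ℕ} :
    Function.Injective (instanceRank : Instance n T → ℕ) := by
  rintro (i | i) (j | j) h <;> simp only [instanceRank] at h
  · rw [Fin.ext h]
  · omega
  · omega
  · rw [Fin.ext (Nat.add_left_cancel h)]

theorem instanceRank_lt_of_activeAt {n T : ℕ} {F : Fin T → Fin n} {τ : Fin T}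
    {x : Instance n T} (h : ActiveAt F τ x) : instanceRank x < instanceRank (n := n) (.inr τ) := by
  rcases x with i | σ
  · simp only [instanceRank]; omega
  · have := h.1
    simp only [instanceRank]; omega

/-- The form of the extremal count used for cuts. The set may have more than k nodes; the surplus is
absorbed by monotonicity of `rotatingSum` in k. -/
theorem rotatingSum_le_sum_sub {n k d : ℕ} (hd : d < n) (A : Finset (Fin n)) (hA : k ≤ A.card)
    (key : Fin n → ℕ) (hkey : Set.InjOn key A) : rotatingSum n k d ≤
      ∑ a ∈ A, (d - (A.filter fun b : Fin n => key b < key a ∧ family n d b ≠ family n d a).card) := by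
  have hcard : A.card ≤ n := by simpa using Finset.card_le_univ A
  have h1 := sum_card_ne_add_sum_gridRow_le key (fun a => family n d a) (families_pos hd)
    (r := n % (n - d)) A hkey (fun a _ => family_le hd a) (by
      rw [← card_family_eq_zero hd, ← card_filter_fin n fun a => family n d a = 0]
      exact Finset.card_le_card (Finset.filter_subset_filter _ (Finset.subset_univ _)))
  have h2 := rotatingSum_add_sum hd hcard
  have h3 : ∑ a ∈ A, d ≤ ∑ a ∈ A,
      (d - (A.filter fun b : Fin n => key b < key a ∧ family n d b ≠ family n d a).card) +
      ∑ a ∈ A, (A.filter fun b : Fin n => key b < key a ∧ family n d b ≠ family n d a).card := by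
    rw [← Finset.sum_add_distrib]
    exact Finset.sum_le_sum fun a _ => by omega
  rw [Finset.sum_const, smul_eq_mul] at h3
  have h4 := rotatingSum_mono (n := n) (d := d) hA
  omega

theorem rotatingSum_mul_le_minCut {n k d T : ℕ} (hd : d < n) {α β : ℝ≥0∞}
    (hα : d * β ≤ α) (F : Fin T → Fin n) (S : {S : Finset (Fin n) // S.card = k}) :
    rotatingSum n k d * β ≤
      minCut (capacity k (fhsHelpers n d) F α β) .source (.collector S) := by
  classical
  refine le_iInf ?_
  rintro ⟨U, hs, ht⟩
  simp only
  by_cases hX : ∃ u ∈ U, ∃ v ∉ U, capacity k (fhsHelpers n d) F α β u v = ⊤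
  · obtain ⟨u, hu, v, hv, h⟩ := hX
    rw [(ENNReal.sum_eq_top).2 ⟨u, hu, (ENNReal.sum_eq_top).2 ⟨v, by simpa using hv, h⟩⟩]
    exact le_top
  push Not at hX
  rw [Finset.sum_comm]
  -- The nodes with some instance whose output is on the sink side; `g` below selects the earliest
  -- such instance of each.
  set A : Finset (Fin n) := Finset.univ.filter
    fun a => ∃ x : Instance n T, Vertex.out x ∉ U ∧ nodeIndex F x = a with hA
  have hfirst : ∀ a, ∃ x : Instance n T, a ∈ A → Vertex.out x ∉ U ∧ nodeIndex F x = a ∧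
      ∀ y, Vertex.out y ∉ U → nodeIndex F y = a → instanceRank x ≤ instanceRank y := by
    intro a
    by_cases ha : a ∈ A
    · obtain ⟨x₀, h₀⟩ := (Finset.mem_filter.1 ha).2
      obtain ⟨x, hx, hmin⟩ := Finset.exists_min_image
        ((Finset.univ : Finset (Instance n T)).filter
          fun x => Vertex.out x ∉ U ∧ nodeIndex F x = a) instanceRank ⟨x₀, by simpa using h₀⟩
      rw [Finset.mem_filter] at hx
      exact ⟨x, fun _ => ⟨hx.2.1, hx.2.2, fun y h1 h2 => hmin y (by simp [h1, h2])⟩⟩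
    · exact ⟨.inl a, fun h => absurd h ha⟩
  choose g hg using hfirst
  have hginj : ∀ a ∈ A, ∀ b ∈ A, g a = g b → a = b := fun a ha b hb h => by
    rw [← (hg a ha).2.1, ← (hg b hb).2.1, h]
  have hSA : S.1 ⊆ A := by
    intro a ha
    obtain ⟨x, hx, hxa⟩ := exists_activeAt F T a
    rw [hA, Finset.mem_filter]
    refine ⟨Finset.mem_univ _, x, fun hxU => hX _ hxU _ ht ?_, hxa⟩
    simp [capacity, hx, hxa, ha]
  have hkA : k ≤ A.card := by
    rw [← S.2]
    exact Finset.card_le_card hSA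
  -- One sink-side vertex per node of `A`. These are distinct, so the capacities crossing into them
  -- may be added.
  let vtx : Fin n → Vertex n k T := fun a =>
    if Vertex.inp (g a) ∈ U then .out (g a) else .inp (g a)
  have hvtxU : ∀ a ∈ A, vtx a ∉ U := by
    intro a ha
    simp only [vtx]
    split_ifs with h
    · exact (hg a ha).1
    · exact h
  have hvtx_inj : Set.InjOn vtx A := by
    intro a ha b hb h
    refine hginj a ha b hb ?_
    simp only [vtx] at h
    split_ifs at h <;> simpa using h
  have hflow : ∀ a ∈ A, ((d - (A.filter fun b : Fin n => instanceRank (g b) < instanceRank (g a) ∧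
      family n d b ≠ family n d a).card : ℕ) : ℝ≥0∞) * β ≤
      ∑ u ∈ U, capacity k (fhsHelpers n d) F α β u (vtx a) := by
    intro a ha
    by_cases h : Vertex.inp (g a) ∈ U
    · calc _ ≤ (d : ℝ≥0∞) * β := by gcongr; exact Nat.sub_le _ _
        _ ≤ α := hα
        _ = capacity k (fhsHelpers n d) F α β (.inp (g a)) (vtx a) := by
          simp [vtx, h, capacity]
        _ ≤ _ := Finset.single_le_sum
          (f := fun u => capacity k (fhsHelpers n d) F α β u (vtx a)) (fun _ _ => zero_le) h
    · have hv : vtx a = .inp (g a) := if_neg h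
      rw [hv]
      have hga := hg a ha
      rcases hcase : g a with i | τ
      · rw [hcase] at h
        exact absurd rfl (hX _ hs _ h)
      · rw [hcase] at hga
        have hFτ : F τ = a := hga.2.1
        choose act hact using exists_activeAt F τ
        set B := (fhsHelpers n d a).filter fun b => Vertex.out (act b) ∈ U with hB
        have hinj : Set.InjOn (fun b => (Vertex.out (act b) : Vertex n k T)) B := by
          intro b _ b' _ hbb
          have : act b = act b' := by simpa using hbb
          rw [← (hact b).2, this, (hact b').2]
        -- A helper whose active instance is not in `U` lies in `A`, and its earliest sink-side
        -- instance is no later than that active one, hence older than the newcomer.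
        have hcount : d ≤ B.card + (A.filter fun b : Fin n => instanceRank (g b) <
            instanceRank (n := n) (.inr τ) ∧ family n d b ≠ family n d a).card := by
          refine (card_fhsHelpers hd a).ge.trans ?_
          refine (Finset.card_le_card fun b hb => ?_).trans (Finset.card_union_le _ _)
          rw [Finset.mem_union, hB, Finset.mem_filter, Finset.mem_filter]
          by_cases hbU : Vertex.out (act b) ∈ U
          · exact Or.inl ⟨hb, hbU⟩
          · have hbA : b ∈ A := by
              rw [hA, Finset.mem_filter]
              exact ⟨Finset.mem_univ _, act b, hbU, (hact b).2⟩
            exact Or.inr ⟨hbA, ((hg b hbA).2.2 _ hbU (hact b).2).trans_lt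
              (instanceRank_lt_of_activeAt (hact b).1), family_ne_of_mem_fhsHelpers hd hb⟩
        calc _ ≤ (B.card : ℝ≥0∞) * β := by gcongr; omega
          _ = ∑ b ∈ B, capacity k (fhsHelpers n d) F α β (.out (act b)) (.inp (.inr τ)) := by
            rw [← nsmul_eq_mul, ← Finset.sum_const]
            refine Finset.sum_congr rfl fun b hb => ?_
            rw [hB, Finset.mem_filter] at hb
            simp only [capacity]
            rw [if_pos ⟨(hact b).1, by rw [(hact b).2, hFτ]; exact hb.1⟩]
          _ = ∑ u ∈ B.image fun b => Vertex.out (act b),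
              capacity k (fhsHelpers n d) F α β u (.inp (.inr τ)) := by
            rw [Finset.sum_image hinj]
          _ ≤ _ := by
            refine Finset.sum_le_sum_of_subset fun u hu => ?_
            obtain ⟨b, hb, rfl⟩ := Finset.mem_image.1 hu
            exact (Finset.mem_filter.1 hb).2
  have hsum := rotatingSum_le_sum_sub hd A hkA (fun a => instanceRank (g a))
    fun a ha b hb h => hginj a ha b hb (instanceRank_injective h)
  calc (rotatingSum n k d : ℝ≥0∞) * β ≤
      (∑ a ∈ A, (d - (A.filter fun b : Fin n =>
        instanceRank (g b) < instanceRank (g a) ∧ family n d b ≠ family n d a).card) : ℕ) * β := by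
        gcongr
    _ ≤ ∑ a ∈ A, ∑ u ∈ U, capacity k (fhsHelpers n d) F α β u (vtx a) := by
      rw [Nat.cast_sum, Finset.sum_mul]
      exact Finset.sum_le_sum hflow
    _ = ∑ v ∈ A.image vtx, ∑ u ∈ U, capacity k (fhsHelpers n d) F α β u v := by
      rw [Finset.sum_image hvtx_inj]
    _ ≤ _ := by
      refine Finset.sum_le_sum_of_subset fun v hv => ?_
      obtain ⟨a, ha, rfl⟩ := Finset.mem_image.1 hv
      exact Finset.mem_compl.2 (hvtxU a ha)

/-! ### Upper bounds from failures in rotating order. -/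

theorem card_helpers_not_failed_le {n d i : ℕ} (hd : d < n) (hi : i < n) :
    ((fhsHelpers n d ⟨rotatingNode n d i, rotatingNode_lt hd hi⟩).filter
      fun a : Fin n => ∀ j < i, rotatingNode n d j ≠ a).card ≤
      d + gridRow (n / (n - d)) (n % (n - d)) i - i := by
  set D := fhsHelpers n d ⟨rotatingNode n d i, rotatingNode_lt hd hi⟩ with hD
  set J := (Finset.range i).filter fun j =>
    gridCol (n / (n - d)) (n % (n - d)) j ≠ gridCol (n / (n - d)) (n % (n - d)) i with hJ
  have h1 : J.card ≤ (D.filter fun a : Fin n => ¬ ∀ j < i, rotatingNode n d j ≠ a).card := by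
    rw [← Finset.card_image_of_injOn (s := J) (f := rotatingNode n d),
      ← Finset.card_image_of_injective _ Fin.val_injective]
    · refine Finset.card_le_card fun x hx => ?_
      obtain ⟨j, hj, rfl⟩ := Finset.mem_image.1 hx
      rw [hJ, Finset.mem_filter, Finset.mem_range] at hj
      refine Finset.mem_image.2 ⟨_, Finset.mem_filter.2
        ⟨rotatingNode_mem_fhsHelpers hd hi hj.1 hj.2, fun h => h j hj.1 rfl⟩, rfl⟩
    · refine (rotatingNode_injOn hd).mono fun j hj => ?_
      have := (Finset.mem_filter.1 hj).1
      rw [Finset.mem_range] at this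
      exact this.trans hi
  have h2 := Finset.card_filter_add_card_filter_not (s := D)
    (fun a : Fin n => ∀ j < i, rotatingNode n d j ≠ a)
  rw [hD, card_fhsHelpers hd, ← hD] at h2
  have h3 : i ≤ J.card + gridRow (n / (n - d)) (n % (n - d)) i :=
    le_card_gridCol_ne_add_gridRow (families_pos hd) (n % (n - d)) i
  omega

/-- Cuts in the information flow graph where the nodes fail in the rotating order and the
collector contacts the newcomers; `I` is the set of newcomers that are cut at their storage. -/
theorem schemeMinCut_le {n k d : ℕ} (hd : d < n) (hk : k ≤ n) (α β : ℝ≥0∞)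
    (I : Finset (Fin k)) : schemeMinCut k (fhsHelpers n d) α β ≤
      ∑ τ : Fin k, if τ ∈ I then α else
        ((d + gridRow (n / (n - d)) (n % (n - d)) τ - τ : ℕ) : ℝ≥0∞) * β := by
  classical
  have hlt : ∀ τ : Fin k, (τ : ℕ) < n := fun τ => τ.2.trans_le hk
  set F : Fin k → Fin n := fun τ => ⟨rotatingNode n d τ, rotatingNode_lt hd (hlt τ)⟩ with hF
  have hFinj : Function.Injective F := fun τ σ h =>
    Fin.ext (rotatingNode_injOn hd (hlt τ) (hlt σ) (by simpa [hF] using h))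
  let S : {S : Finset (Fin n) // S.card = k} :=
    ⟨Finset.univ.image F, by rw [Finset.card_image_of_injective _ hFinj]; simp⟩
  refine ((iInf_le _ k).trans <| (iInf_le _ F).trans <| iInf_le _ S).trans ?_
  -- The sink side. It contains all newcomer outputs, so a newcomer input in it is reached across
  -- the cut only from initial nodes that have not yet failed.
  set W : Finset (Vertex n k k) := insert (.collector S)
    ((Finset.univ.image fun τ => .out (.inr τ)) ∪ (Iᶜ.image fun τ => .inp (.inr τ))) with hW
  refine (iInf_le _ ⟨Wᶜ, by simp [hW], by simp [hW]⟩).trans ?_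
  simp only [compl_compl]
  rw [Finset.sum_comm]
  have hcol : ∑ u ∈ Wᶜ, capacity k (fhsHelpers n d) F α β u (.collector S) = 0 := by
    refine Finset.sum_eq_zero fun u hu => ?_
    rcases u with _ | x | x | S' <;> try rfl
    rcases x with i | τ
    · simp only [capacity]
      rw [if_neg]
      rintro ⟨h1, h2⟩
      obtain ⟨τ, -, h⟩ := Finset.mem_image.1 h2
      exact h1 τ τ.2 h
    · simp [hW] at hu
  have hout : ∀ τ, ∑ u ∈ Wᶜ, capacity k (fhsHelpers n d) F α β u (.out (.inr τ)) =
      if τ ∈ I then α else 0 := by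
    intro τ
    have h : ∀ u, capacity k (fhsHelpers n d) F α β u (.out (.inr τ)) =
        if u = .inp (.inr τ) then α else 0 := by
      intro u
      rcases u with _ | x | x | S' <;> simp [capacity]
    simp only [h, Finset.sum_ite_eq']
    simp [hW]
  have hinp : ∀ τ, ∑ u ∈ Wᶜ, capacity k (fhsHelpers n d) F α β u (.inp (.inr τ)) ≤
      ((d + gridRow (n / (n - d)) (n % (n - d)) τ - τ : ℕ) : ℝ≥0∞) * β := by
    intro τ
    set N := (fhsHelpers n d (F τ)).filter fun a : Fin n => ∀ j < (τ : ℕ), rotatingNode n d j ≠ a with hN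
    have h : ∀ u ∈ Wᶜ, capacity k (fhsHelpers n d) F α β u (.inp (.inr τ)) ≤
        if u ∈ N.image fun a => Vertex.out (.inl a) then β else 0 := by
      intro u hu
      rcases u with _ | x | x | S' <;> try exact zero_le
      rcases x with i | σ
      · simp only [capacity]
        by_cases h1 : ActiveAt F τ (.inl i) ∧ nodeIndex F (.inl i) ∈ fhsHelpers n d (F τ)
        · rw [if_pos h1, if_pos]
          refine Finset.mem_image.2 ⟨i, Finset.mem_filter.2 ⟨h1.2, fun j hj hji => ?_⟩, rfl⟩
          exact h1.1 ⟨j, hj.trans τ.2⟩ hj (Fin.ext hji)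
        · rw [if_neg h1]
          exact zero_le
      · simp [hW] at hu
    calc _ ≤ ∑ u ∈ Wᶜ, if u ∈ N.image fun a => Vertex.out (.inl a) then β else 0 :=
          Finset.sum_le_sum h
      _ ≤ ∑ u, if u ∈ N.image fun a => Vertex.out (.inl a) then β else 0 :=
          Finset.sum_le_sum_of_subset (Finset.subset_univ _)
      _ = ((N.image fun a => (Vertex.out (.inl a) : Vertex n k k)).card : ℝ≥0∞) * β := by
          rw [Finset.sum_ite_mem, Finset.univ_inter, Finset.sum_const, nsmul_eq_mul]
      _ ≤ _ := by
          gcongr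
          exact Finset.card_image_le.trans (card_helpers_not_failed_le hd (hlt τ))
  rw [hW, Finset.sum_insert (by simp), Finset.sum_union (by simp [Finset.disjoint_left]),
    Finset.sum_image (fun _ _ _ _ h => by simpa using h),
    Finset.sum_image (fun _ _ _ _ h => by simpa using h), ← hW, hcol, zero_add,
    Finset.sum_congr rfl fun τ _ => hout τ]
  refine (add_le_add_right (Finset.sum_le_sum fun τ _ => hinp τ) _).trans ?_
  rw [← Finset.sum_filter_add_sum_filter_not Finset.univ (· ∈ I) fun τ => if τ ∈ I then α else
    ((d + gridRow (n / (n - d)) (n % (n - d)) τ - τ : ℕ) : ℝ≥0∞) * β,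
    Finset.sum_congr rfl fun τ hτ => if_pos (Finset.mem_filter.1 hτ).2,
    Finset.sum_congr (s₁ := Finset.univ.filter fun τ => τ ∉ I) rfl
      fun τ hτ => if_neg (Finset.mem_filter.1 hτ).2, ← Finset.sum_filter]
  refine le_of_eq ?_
  congr 1
  refine Finset.sum_congr ?_ fun _ _ => rfl
  ext τ
  simp

theorem rotatingSum_mul_le_schemeMinCut {n k d : ℕ} (hd : d < n) {α β : ℝ≥0∞}
    (hα : d * β ≤ α) : rotatingSum n k d * β ≤ schemeMinCut k (fhsHelpers n d) α β :=
  le_iInf fun _ => le_iInf fun F => le_iInf fun S => rotatingSum_mul_le_minCut hd hα F S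

theorem schemeMinCut_le_rotatingSum_mul {n k d : ℕ} (hd : d < n) (hk : k ≤ n) (α β : ℝ≥0∞) :
    schemeMinCut k (fhsHelpers n d) α β ≤ rotatingSum n k d * β := by
  refine (schemeMinCut_le hd hk α β ∅).trans (le_of_eq ?_)
  simp only [Finset.notMem_empty, if_false]
  rw [rotatingSum, Nat.cast_sum, Finset.sum_mul, ← Fin.sum_univ_eq_sum_range (fun i =>
    ((d + gridRow (n / (n - d)) (n % (n - d)) i - i : ℕ) : ℝ≥0∞) * β)]

/-- Only the first newcomer is cut at its storage, which trades its term dβ for α. The additive form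
avoids subtraction in `ℝ≥0∞`; at β = M/S cancelling M leaves dβ ≤ α. -/
theorem schemeMinCut_add_le {n k d : ℕ} (hd : d < n) (hk1 : 0 < k) (hk : k ≤ n) (α β : ℝ≥0∞) :
    schemeMinCut k (fhsHelpers n d) α β + d * β ≤ α + rotatingSum n k d * β := by
  obtain ⟨k, rfl⟩ := Nat.exists_eq_succ_of_ne_zero hk1.ne'
  refine (add_le_add_left (schemeMinCut_le hd hk α β {0}) _).trans (le_of_eq ?_)
  rw [rotatingSum, Nat.cast_sum, Finset.sum_mul, ← Fin.sum_univ_eq_sum_range (fun i =>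
    ((d + gridRow (n / (n - d)) (n % (n - d)) i - i : ℕ) : ℝ≥0∞) * β), Fin.sum_univ_succ,
    Fin.sum_univ_succ]
  have h0 : gridRow (n / (n - d)) (n % (n - d)) 0 = 0 :=
    Nat.le_zero.1 (gridRow_le (families_pos hd) _ 0)
  simp [h0, Fin.succ_ne_zero]
  ring

theorem isMBRPoint_fhs {n k d : ℕ} (hd1 : 0 < d) (hd : d < n) (hk1 : 0 < k) (hk : k ≤ n)
    (M : ℝ≥0) : IsMBRPoint k (fhsHelpers n d) M (d * (M / rotatingSum n k d))
      (M / rotatingSum n k d) := by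
  have hS : (0 : ℝ≥0) < rotatingSum n k d := by
    exact_mod_cast hd1.trans_le (le_rotatingSum hk1)
  have hM : ((rotatingSum n k d : ℝ≥0) * (M / rotatingSum n k d) : ℝ≥0) = M :=
    mul_div_cancel₀ _ hS.ne'
  set β := M / rotatingSum n k d with hβ
  have hM' : (rotatingSum n k d : ℝ≥0∞) * β = M := by
    rw [← hM]; push_cast; rfl
  refine ⟨⟨?_, ?_⟩, ?_, ?_⟩
  · rw [Set.mem_ofPred_eq, ← hM']
    exact rotatingSum_mul_le_schemeMinCut hd le_top
  · intro b hb
    have h := le_trans hb (schemeMinCut_le_rotatingSum_mul hd hk ⊤ b)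
    have h' : M ≤ rotatingSum n k d * b := by exact_mod_cast h
    rw [hβ, div_le_iff₀ hS, mul_comm]
    exact h'
  · rw [Set.mem_ofPred_eq, ← hM']
    refine rotatingSum_mul_le_schemeMinCut hd ?_
    push_cast
    exact le_rfl
  · intro a ha
    have h := (add_le_add_left ha _).trans (schemeMinCut_add_le hd hk1 hk a β)
    rw [hM'] at h
    have h' : M + d * β ≤ a + M := by exact_mod_cast h
    rw [add_comm a] at h'
    exact le_of_add_le_add_left h'

/-! ### A closed form of the rotating sum -/

/-- Twice the sum of `i / w` over `i < k`. -/
def twiceDivSum (w k : ℕ) : ℕ := k / w * (k + k - w * (k / w + 1))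

theorem two_mul_sum_div (w k : ℕ) :
    2 * ∑ i ∈ Finset.range k, i / w = twiceDivSum w k := by
  -- Stated without subtraction for the induction. The quotient changes only when k + 1 = w(k / w +
  -- 1).
  have h : ∀ k, 2 * ∑ i ∈ Finset.range k, i / w + k / w * (w * (k / w + 1)) =
      k / w * (k + k) := by
    intro k
    induction k with
    | zero => simp
    | succ k ih =>
      rw [Finset.sum_range_succ, Nat.succ_div]
      split_ifs with hdvd
      · have hk : k + 1 = w * (k / w + 1) := by
          have := Nat.succ_div_of_dvd hdvd
          rw [← this, Nat.mul_div_cancel' hdvd]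
        generalize k / w = q at *
        generalize ∑ i ∈ Finset.range k, i / w = s at *
        have h2 : (q + 1) * (w * (q + 1 + 1)) = q * (w * (q + 1)) + 2 * (w * (q + 1)) := by ring
        rw [h2, ← hk]
        rw [← hk] at ih
        linarith
      · rw [add_zero]
        linarith
  rw [twiceDivSum, Nat.mul_sub, ← h k, Nat.add_sub_cancel]

/-- Twice the sum of the rows of the first `k` cells. -/
def twiceGridRowSum (c r k : ℕ) : ℕ :=
  -- With truncated subtraction k - (k - x) is min(k, x), the number of cells in the first r rows; k
  -- - x counts the remaining ones.
  twiceDivSum (c + 1) (k - (k - r * (c + 1))) + twiceDivSum c (k - r * (c + 1)) +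
    (r * (k - r * (c + 1)) + r * (k - r * (c + 1)))

theorem two_mul_sum_gridRow (c r k : ℕ) :
    2 * ∑ i ∈ Finset.range k, gridRow c r i = twiceGridRowSum c r k := by
  have h1 : ∀ l ≤ r * (c + 1), ∑ i ∈ Finset.range l, gridRow c r i =
      ∑ i ∈ Finset.range l, i / (c + 1) := fun l hl =>
    Finset.sum_congr rfl fun i hi => if_pos ((Finset.mem_range.1 hi).trans_le hl)
  rw [twiceGridRowSum, ← two_mul_sum_div c, ← two_mul_sum_div (c + 1)]
  rcases le_total k (r * (c + 1)) with h | h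
  · simp [Nat.sub_eq_zero_of_le h, h1 k h]
  · obtain ⟨l, rfl⟩ := Nat.exists_eq_add_of_le h
    have h2 : ∀ i, gridRow c r (r * (c + 1) + i) = r + i / c := fun i => by
      rw [gridRow, if_neg (by omega), Nat.add_sub_cancel_left]
    rw [Finset.sum_range_add, h1 _ le_rfl, Nat.add_sub_cancel_left, Nat.add_sub_cancel]
    simp only [h2, Finset.sum_add_distrib, Finset.sum_const, Finset.card_range, smul_eq_mul]
    ring

/-- Twice `rotatingSum n k d`. -/
def twiceRotatingSum (n k d : ℕ) : ℕ :=
  -- Twice the sum of i over i < k is k² - k, which explains the extra 1. The remainder is spelled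
  -- out because the machine has no mod instruction.
  k * (d + d + 1) + twiceGridRowSum (n / (n - d)) (n - n / (n - d) * (n - d)) k - k * k

theorem twiceRotatingSum_eq {n k d : ℕ} (hd : d < n) (hk : k ≤ n) :
    twiceRotatingSum n k d = 2 * rotatingSum n k d := by
  have h1 := rotatingSum_add_sum hd hk
  have h2 : n - n / (n - d) * (n - d) = n % (n - d) := by
    have := Nat.div_add_mod' n (n - d)
    omega
  have h3 : (∑ i ∈ Finset.range k, i) * 2 + k = k * k := by
    rw [Finset.sum_range_id_mul_two]
    cases k with
    | zero => rfl
    | succ k => rw [Nat.add_sub_cancel]; ring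
  rw [twiceRotatingSum, h2, ← two_mul_sum_gridRow, Nat.mul_add, Nat.mul_add]
  omega

/-! ### Straight-line programs -/

/-- Arithmetic instructions, with constants at most `1`. -/
def Instr.IsArith : Instr → Prop
  | .const _ v => v ≤ 1
  | .add _ _ _ => True
  | .sub _ _ _ => True
  | .mul _ _ _ => True
  | .div _ _ _ => True
  | _ => False

theorem size_update_le {f : ℕ → ℕ} {B : ℕ} (hf : ∀ r, (f r).size ≤ B) (dst : ℕ) {v : ℕ}
    (hv : v < 2 ^ (2 * B)) (r : ℕ) : (Function.update f dst v r).size ≤ 2 * B := by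
  rw [Function.update_apply]
  split_ifs
  · exact Nat.size_le.2 hv
  · exact (hf r).trans (by omega)

/-- One instruction at most doubles the bound on register lengths. A program of fixed length L thus
keeps lengths below 2^L times the input length, and its cost is quadratic in that length. -/
theorem Instr.IsArith.exec_spec {c : Instr} (hc : c.IsArith) {s : Config} {B : ℕ} (hB : 1 ≤ B)
    (hs : ∀ r, (s.reg r).size ≤ B) :
    (∀ r, ((c.exec s).reg r).size ≤ 2 * B) ∧ c.cost s ≤ (1 + B) ^ 2 ∧
      (c.exec s).pc = s.pc + 1 := by
  have hlt : ∀ r, s.reg r < 2 ^ B := fun r => Nat.size_le.1 (hs r)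
  have hpow : 2 ^ (2 * B) = 2 ^ B * 2 ^ B := by rw [two_mul, pow_add]
  have h2 : 2 ≤ 2 ^ B := by
    calc 2 = 2 ^ 1 := rfl
      _ ≤ 2 ^ B := Nat.pow_le_pow_right (by norm_num) hB
  have h22 : 2 * 2 ^ B ≤ 2 ^ B * 2 ^ B := Nat.mul_le_mul_right _ h2
  have hlin : 1 + B + B ≤ (1 + B) ^ 2 := by nlinarith
  rcases c with ⟨x, v⟩ | ⟨x, a, b⟩ | ⟨x, a, b⟩ | ⟨x, a, b⟩ | ⟨x, a, b⟩ | ⟨x, a⟩ | ⟨a, b⟩ | ⟨a, b⟩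
  · have hv : v ≤ 1 := hc
    refine ⟨size_update_le hs x (by omega), ?_, rfl⟩
    have : v.size ≤ 1 := Nat.size_le.2 (by omega)
    simp only [Instr.cost]
    omega
  · refine ⟨size_update_le hs x ?_, ?_, rfl⟩
    · have := hlt a
      have := hlt b
      omega
    · have := hs a
      have := hs b
      simp only [Instr.cost]
      omega
  · refine ⟨size_update_le hs x ?_, ?_, rfl⟩
    · have := hlt a
      omega
    · have := hs a
      have := hs b
      simp only [Instr.cost]
      omega
  · refine ⟨size_update_le hs x ?_, ?_, rfl⟩
    · rw [hpow]
      exact Nat.mul_lt_mul'' (hlt a) (hlt b)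
    · rw [sq]
      exact Nat.mul_le_mul (Nat.add_le_add_left (hs a) 1) (Nat.add_le_add_left (hs b) 1)
  · refine ⟨size_update_le hs x ?_, ?_, rfl⟩
    · have := hlt a
      have := Nat.div_le_self (s.reg a) (s.reg b)
      omega
    · rw [sq]
      exact Nat.mul_le_mul (Nat.add_le_add_left (hs a) 1) (Nat.add_le_add_left (hs b) 1)
  all_goals exact hc.elim

theorem exists_haltsIn_of_isArith (Q : List Instr) (hQ : ∀ c ∈ Q, c.IsArith) :
    -- The already executed prefix `pre` is kept so that the program counter refers to the whole
    -- program throughout the induction.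
    ∀ (pre : List Instr) (s : Config) (B : ℕ), 1 ≤ B → (∀ r, (s.reg r).size ≤ B) →
      s.pc = pre.length → ∃ t, HaltsIn (pre ++ Q) s t (Q.foldl (fun s c => c.exec s) s) ∧
        t ≤ Q.length * (1 + 2 ^ Q.length * B) ^ 2 := by
  induction Q with
  | nil =>
    intro pre s B _ _ hpc
    exact ⟨0, .halt s (by simp [hpc]), by simp⟩
  | cons c Q ih =>
    intro pre s B hB hs hpc
    obtain ⟨h1, h2, h3⟩ := (hQ c (by simp)).exec_spec hB hs
    obtain ⟨t, ht, hle⟩ := ih (fun c' h => hQ c' (by simp [h])) (pre ++ [c]) (c.exec s) (2 * B)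
      (by omega) h1 (by simp [h3, hpc])
    rw [List.append_assoc, List.singleton_append] at ht
    refine ⟨c.cost s + t, .step s _ t c (by simp [hpc]) ht, ?_⟩
    have e : 2 ^ Q.length * (2 * B) = 2 ^ (c :: Q).length * B := by
      rw [List.length_cons, pow_succ]; ring
    rw [e] at hle
    have h4 : (1 + B) ^ 2 ≤ (1 + 2 ^ (c :: Q).length * B) ^ 2 :=
      Nat.pow_le_pow_left (Nat.add_le_add_left (Nat.le_mul_of_pos_left B (by positivity)) 1) 2
    generalize (1 + 2 ^ (c :: Q).length * B) ^ 2 = z at *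
    rw [List.length_cons, Nat.succ_mul]
    omega

/-- A program that computes the MBR point from `n, k, d, a, b` for file size `a / b`. -/
def mbrProgram : List Instr :=
  -- Registers 10, 11, 13 hold m, c, r; 18 and 17 hold the cell counts in the first r rows and after
  -- them; 24 and 30 the two values of `twiceDivSum`; 34 and 40 hold `twiceGridRowSum` and
  -- `twiceRotatingSum`.
  [.sub 10 0 2, .div 11 0 10, .mul 12 11 10, .sub 13 0 12, .const 14 1, .add 15 11 14,
   .mul 16 13 15, .sub 17 1 16, .sub 18 1 17,
   .div 19 18 15, .add 20 19 14, .mul 21 15 20, .add 22 18 18, .sub 23 22 21, .mul 24 19 23,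
   .div 25 17 11, .add 26 25 14, .mul 27 11 26, .add 28 17 17, .sub 29 28 27, .mul 30 25 29,
   .mul 31 13 17, .add 32 31 31, .add 33 24 30, .add 34 33 32,
   .add 35 2 2, .add 36 35 14, .mul 37 1 36, .add 38 37 34, .mul 39 1 1, .sub 40 38 39,
   .mul 41 4 40, .add 42 3 3, .mul 43 2 42,
   -- Register 6 is never written and stays 0, so these additions are copies. Inputs are overwritten
   -- only here.
   .add 0 43 6, .add 1 41 6, .add 2 42 6, .add 3 41 6, .add 4 43 6, .add 5 41 6]

theorem mbrProgram_isArith : ∀ c ∈ mbrProgram, c.IsArith := by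
  simp [mbrProgram, Instr.IsArith]

/-- Holds by `rfl` because the closed forms were written with exactly the operations of the program.
-/
theorem mbrProgram_result (n k d a b : ℕ) :
    let s := mbrProgram.foldl (fun s c => c.exec s) (initConfig [n, k, d, a, b])
    s.reg 0 = d * (a + a) ∧ s.reg 1 = b * twiceRotatingSum n k d ∧
    s.reg 2 = a + a ∧ s.reg 3 = b * twiceRotatingSum n k d ∧
    s.reg 4 = d * (a + a) ∧ s.reg 5 = b * twiceRotatingSum n k d :=
  ⟨rfl, rfl, rfl, rfl, rfl, rfl⟩

theorem size_initConfig_le (n k d a b r : ℕ) :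
    ((initConfig [n, k, d, a, b]).reg r).size ≤ n.size + k.size + d.size + a.size + b.size := by
  rcases r with _ | _ | _ | _ | _ | r <;> simp [initConfig] <;> omega

theorem exists_mbrProgram : ∃ (P : List Instr) (p : Polynomial ℕ), ∀ n k d a b : ℕ,
    2 ≤ n → 1 ≤ k → k ≤ n - 1 → 1 ≤ d → d ≤ n - 1 → 0 < a → 0 < b →
    ∃ (s : Config) (t : ℕ), HaltsIn P (initConfig [n, k, d, a, b]) t s ∧
      t ≤ p.eval (n.size + k.size + d.size + a.size + b.size) ∧
      s.reg 1 ≠ 0 ∧ s.reg 3 ≠ 0 ∧ s.reg 5 ≠ 0 ∧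
      ∃ α β γ : ℝ≥0, IsMBRPoint k (fhsHelpers n d) ((a : ℝ≥0) / b) α β ∧ γ = d * β ∧
        α = (s.reg 0 : ℝ≥0) / s.reg 1 ∧ β = (s.reg 2 : ℝ≥0) / s.reg 3 ∧
        γ = (s.reg 4 : ℝ≥0) / s.reg 5 := by
  refine ⟨mbrProgram, .C mbrProgram.length * (1 + .C (2 ^ mbrProgram.length) * .X) ^ 2, ?_⟩
  intro n k d a b hn hk1 hk hd1 hd ha hb
  have hdn : d < n := by omega
  have hkn : k ≤ n := by omega
  have hsize : 1 ≤ n.size + k.size + d.size + a.size + b.size := by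
    have : 0 < n.size := Nat.size_pos.2 (by omega)
    omega
  obtain ⟨t, ht, hle⟩ := exists_haltsIn_of_isArith mbrProgram mbrProgram_isArith [] _ _ hsize
    (size_initConfig_le n k d a b) rfl
  refine ⟨_, t, ht, ?_, ?_⟩
  · simpa only [Polynomial.eval_mul, Polynomial.eval_pow, Polynomial.eval_add,
      Polynomial.eval_one, Polynomial.eval_C, Polynomial.eval_X] using hle
  obtain ⟨h0, h1, h2, h3, h4, h5⟩ := mbrProgram_result n k d a b
  rw [h0, h1, h2, h3, h4, h5, twiceRotatingSum_eq hdn hkn]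
  have hS : 0 < rotatingSum n k d := lt_of_lt_of_le hd1 (le_rotatingSum hk1)
  have hpos : b * (2 * rotatingSum n k d) ≠ 0 := by positivity
  have hβ : (a : ℝ≥0) / b / rotatingSum n k d =
      ((a + a : ℕ) : ℝ≥0) / (b * (2 * rotatingSum n k d) : ℕ) := by
    push_cast
    rw [← two_mul, div_div, mul_left_comm, mul_div_mul_left _ _ two_ne_zero]
  have hα : (d : ℝ≥0) * ((a : ℝ≥0) / b / rotatingSum n k d) =
      ((d * (a + a) : ℕ) : ℝ≥0) / (b * (2 * rotatingSum n k d) : ℕ) := by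
    rw [hβ, Nat.cast_mul d, mul_div_assoc]
  exact ⟨hpos, hpos, hpos, _, _, _, isMBRPoint_fhs hd1 hdn hk1 hkn _, rfl, hα, hβ, hα⟩

end DistStorage

theorem mainTheorem5 :
    (∀ n k d : ℕ, 2 ≤ n → 1 ≤ k → k ≤ n - 1 → 1 ≤ d → d ≤ n - 1 →
      -- for large storage the rotating permutation is a minimizing family index permutation
      (DistStorage.IsFamilyIndexPermutation n d (DistStorage.rotatingPermutation n d) ∧
        ∀ α β : ℝ, 0 ≤ β → (d : ℝ) * β ≤ α →
          ∀ π : List ℤ, DistStorage.IsFamilyIndexPermutation n d π →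
            DistStorage.permutationCut k d α β (DistStorage.rotatingPermutation n d) ≤
              DistStorage.permutationCut k d α β π) ∧
      -- the MBR point
      (∀ M : ℝ≥0, 0 < M → ∃ α β γ : ℝ≥0,
        DistStorage.IsMBRPoint k (DistStorage.fhsHelpers n d) M α β ∧
        α = γ ∧ γ = d * β ∧
        ((d : ℝ) * β = (d : ℝ) * M / ∑ i ∈ Finset.range k,
          ((d : ℝ) - DistStorage.helpCount (DistStorage.rotatingPermutation n d) i)))) ∧
    -- one program computes the MBR values, for rational file size `a / b`, in polynomial time
    (∃ (P : List DistStorage.Instr) (p : Polynomial ℕ), ∀ n k d a b : ℕ,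
      2 ≤ n → 1 ≤ k → k ≤ n - 1 → 1 ≤ d → d ≤ n - 1 → 0 < a → 0 < b →
      ∃ (s : DistStorage.Config) (t : ℕ),
        DistStorage.HaltsIn P (DistStorage.initConfig [n, k, d, a, b]) t s ∧
        t ≤ p.eval (n.size + k.size + d.size + a.size + b.size) ∧
        s.reg 1 ≠ 0 ∧ s.reg 3 ≠ 0 ∧ s.reg 5 ≠ 0 ∧
        ∃ α β γ : ℝ≥0,
          DistStorage.IsMBRPoint k (DistStorage.fhsHelpers n d) ((a : ℝ≥0) / b) α β ∧
          γ = d * β ∧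
          α = (s.reg 0 : ℝ≥0) / s.reg 1 ∧
          β = (s.reg 2 : ℝ≥0) / s.reg 3 ∧
          γ = (s.reg 4 : ℝ≥0) / s.reg 5) := by
  refine ⟨fun n k d hn hk1 hk hd1 hd => ?_, DistStorage.exists_mbrProgram⟩
  have hdn : d < n := by omega
  have hkn : k ≤ n := by omega
  refine ⟨⟨DistStorage.isFamilyIndexPermutation_rotatingPermutation hdn,
    fun α β hβ hα π hπ => DistStorage.permutationCut_rotatingPermutation_le hdn hkn hβ hα hπ⟩,
    fun M _ => ⟨_, _, _, DistStorage.isMBRPoint_fhs hd1 hdn hk1 hkn M, rfl, rfl, ?_⟩⟩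
  rw [DistStorage.sum_sub_helpCount_rotatingPermutation hdn hkn]
  push_cast
  rw [mul_div_assoc]
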